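/- \textbf{Setting.} Let $S$ be a countable set with the $\sigma$-algebra $2^S$, let $\mu$ be a probability measure on $S$ and $P$ a transition probability kernel on $S$. Let $\mathsf P_\mu$ be the law on $S^{\mathbb N}$ of the time-homogeneous Markov chain $\Phi=(\Phi_0,\Phi_1,\dots)$ with initial distribution $\mu$ and transition kernel $P$. For $A\subseteq S$ put $$\mathrm{Fin}(A)=\bigcup_{n}\bigcap_{m\ge n}\{\Phi_m\notin A\},\qquad \mathrm{Inf}(A)=\bigcap_{n}\bigcup_{m\ge n}\{\Phi_m\in A\}.$$ For $V:S\to\mathbb R_{\ge0}$ write $PV(s)=\int_S V(u)\,P(s,\mathrm du)$ and $\mu V=\int_S V\,\mathrm d\mu$. Let $(A_1,B_1),\dots,(A_k,B_k)$ be pairs of subsets of $S$ (a Streett acceptance condition). \textbf{Theorem (Proof Rule \#2 is complete for almost-sure reactivity).} Suppose that $$\mathsf P_\mu\Big(\bigcap_{i=1}^k \big(\mathrm{Fin}(A_i)\cup \mathrm{Inf}(B_i)\big)\Big)=1 .$$ Then there exist a set $I\subseteq S$ (supporting invariant) and a function $V_0:S\to\mathbb R_{\ge0}$, sets $J_i\subseteq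 I\setminus A_i$ (absorbing regions), functions $V_i,W_i:S\to\mathbb R_{\ge0}$ (supermartingale certificates), $d_i:\mathbb R_{\ge0}\to\mathbb R_{>0}$ (decrease functions) and $p_i:\mathbb R_{\ge0}\to(0,1]$ (probability functions), for $i=1,\dots,k$, with $PV_0$, $PV_i$, $PW_i$ finite everywhere on $S$, such that $\mu V_0=0$ and the following conditions of Proof Rule \#2 hold. \begin{enumerate} \item \emph{Qualitative safety}, for every $i=1,\dots,k$: (a) $PV_i(s)\le V_i(s)$ for all $s\notin A_i$; (b) $V_i(s)\ge 1$ for all $s\in A_i$; (c) there is $\gamma_i>0$ with $V_i(s)\le 1-\gamma_i$ for all $s\in J_i$. \item \emph{Almost-sure termination}, for every $i=1,\dots,k$: (a) $W_i(s)>0$ for all $s\in I\setminus(B_i\cup J_i)$; (b) $W_i(s)=0$ for all $s\in I\cap(B_i\cup J_i)$; (c) $PW_i(s)\le W_i(s)$ for all $s\in I\setminus(B_i\cup J_i)$; (d) for all $r>0$ and all $s\in I\setminus(B_i\cup J_i)$ with $W_i(s)=r$: $P\big(s,\{s':W_i(s')\le r-d_i(r)\}\big)\ge p_i(r)$; (e)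 $p_i(r_1)\ge p_i(r_2)$ and $d_i(r_1)\ge d_i(r_2)$ whenever $0<r_1\le r_2$. \item \emph{Quantitative safety}: (a) $PV_0(s)\le V_0(s)$ for all $s\in I$; (b) $V_0(s)\ge1$ for all $s\notin I$. \end{enumerate} -/

import Mathlib

open MeasureTheory ProbabilityTheory
open scoped NNReal ENNReal

namespace StreettChain

noncomputable section

variable {S : Type*}

/-- The event of visiting the region `A` only finitely many times. -/
def finVisits (A : Set S) : Set (ℕ → S) := ⋃ n : ℕ, ⋂ m : ℕ, ⋂ _ : n ≤ m, {ω | ω m ∉ A}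

/-- The event of visiting the region `A` infinitely many times. -/
def infVisits (A : Set S) : Set (ℕ → S) := ⋂ n : ℕ, ⋃ m : ℕ, ⋃ _ : n ≤ m, {ω | ω m ∈ A}

/-- The reactivity property of the Streett acceptance condition `(A i, B i)`, `i < k`. -/
def reactivity {k : ℕ} (A B : Fin k → Set S) : Set (ℕ → S) :=
  ⋂ i : Fin k, (finVisits (A i) ∪ infVisits (B i))

variable [MeasurableSpace S]

/-- The law, on the space of infinite trajectories, of the time-homogeneous Markov chain with
initial distribution `μ` and transition kernel `P`. -/
def pathMeasure (μ : Measure S) [IsProbabilityMeasure μ] (P : Kernel S S) [IsMarkovKernel P] :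
    Measure (ℕ → S) :=
  Kernel.trajMeasure (X := fun _ : ℕ => S) μ
    (fun n => P.comap (fun x : (Finset.Iic n → S) => x ⟨n, Finset.mem_Iic.2 le_rfl⟩)
      (measurable_pi_apply _))

/-- The init-expectation `μV`. -/
def initExp (μ : Measure S) (V : S → ℝ≥0) : ℝ≥0∞ := ∫⁻ u, (V u : ℝ≥0∞) ∂μ

/-- The post-expectation `PV`. -/
def postExp (P : Kernel S S) (V : S → ℝ≥0) (s : S) : ℝ≥0∞ := ∫⁻ u, (V u : ℝ≥0∞) ∂(P s)

/-- The requirements of the proof rule on a supporting invariant `I` with `V₀`, absorbing regions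
`J i`, supermartingale certificates `V i`, `W i`, decrease functions `d i` and probability
functions `p i`, for the Streett acceptance condition `(A i, B i)`. -/
structure ProofRuleTwo (P : Kernel S S) {k : ℕ} (A B : Fin k → Set S)
    (I : Set S) (V₀ : S → ℝ≥0) (J : Fin k → Set S) (V W : Fin k → S → ℝ≥0)
    (d p : Fin k → ℝ≥0 → ℝ≥0) : Prop where
  -- post-expectations are functions with finite values
  post_V₀_lt_top : ∀ s, postExp P V₀ s < ∞
  post_V_lt_top : ∀ i s, postExp P (V i) s < ∞
  post_W_lt_top : ∀ i s, postExp P (W i) s < ∞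
  -- codomains of the decrease and probability functions, location of the absorbing regions
  d_pos : ∀ i r, 0 < d i r
  p_pos : ∀ i r, 0 < p i r
  p_le_one : ∀ i r, p i r ≤ 1
  absorbing_subset : ∀ i, J i ⊆ I \ A i
  -- qualitative safety
  V_post : ∀ i, ∀ s ∉ A i, postExp P (V i) s ≤ V i s
  V_ge_one : ∀ i, ∀ s ∈ A i, 1 ≤ V i s
  V_gap : ∀ i, ∃ γ : ℝ, 0 < γ ∧ ∀ s ∈ J i, (V i s : ℝ) ≤ 1 - γ
  -- almost-sure termination
  W_pos : ∀ i, ∀ s ∈ I \ (B i ∪ J i), 0 < W i s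
  W_zero : ∀ i, ∀ s ∈ I ∩ (B i ∪ J i), W i s = 0
  W_post : ∀ i, ∀ s ∈ I \ (B i ∪ J i), postExp P (W i) s ≤ W i s
  W_drift : ∀ i, ∀ r : ℝ≥0, 0 < r → ∀ s ∈ I \ (B i ∪ J i), W i s = r →
    (p i r : ℝ≥0∞) ≤ P s {s' | (W i s' : ℝ) ≤ (r : ℝ) - (d i r : ℝ)}
  p_antitone : ∀ i, ∀ r₁ r₂ : ℝ≥0, 0 < r₁ → 0 < r₂ → r₁ ≤ r₂ → p i r₂ ≤ p i r₁
  d_antitone : ∀ i, ∀ r₁ r₂ : ℝ≥0, 0 < r₁ → 0 < r₂ → r₁ ≤ r₂ → d i r₂ ≤ d i r₁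
  -- quantitative safety
  V₀_post : ∀ s ∈ I, postExp P V₀ s ≤ V₀ s
  V₀_ge_one : ∀ s ∉ I, 1 ≤ V₀ s

end

end StreettChain

open MeasureTheory ProbabilityTheory Filter Topology
open scoped NNReal ENNReal

namespace StreettChain

/-! ### Staying probabilities and their harmonicity -/

section StayProbability

variable {S : Type*} [MeasurableSpace S]

/-! Let `I` be the states reached with positive probability: it carries `μ` and is closed under `P`,
so the indicator of its complement serves as `V₀`. Let `a i` be the probability of never visiting `A
i`. Then `V i = 1 - a i` is harmonic off `A i` and equals 1 on it, and `J i = I ∩ {1/2 ≤ a i}` gives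
the gap 1/2.

The crux is that `C = I \ (B i ∪ J i)` is left almost surely (`stayLim_eq_zero_of_ae`). A trajectory
that stays in `C` misses `B i`, hence by hypothesis eventually avoids `A i`; but it does so among
states where `a i < 1/2`, and a staying probability bounded by 1/2 vanishes
(`stayLim_eq_zero_of_le_half`).

On such a `C` take `W = H + G`, where `H` is superharmonic with finite sublevel sets (a sum of
probabilities of reaching remote sets before leaving `C`) and `G` is bounded and strictly
superharmonic. The strict inequality forces a drop of `W` with positive probability at each state;
finite sublevel sets turn these drops and probabilities into positive antitone `d` and `p`. -/

open Classical in
/-- The probability that the chain started in `s`, within the first `j` steps, either stays in `C`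
or visits `F` before it leaves `C`. -/
noncomputable def stay (P : Kernel S S) (F C : Set S) : ℕ → S → ℝ≥0∞
  | 0, _ => 1
  | j + 1, s => if s ∈ C then (if s ∈ F then 1 else ∫⁻ u, stay P F C j u ∂(P s)) else 0

/-- The probability that the chain started in `s` either stays in `C` forever or visits `F` before
it leaves `C`. -/
noncomputable def stayLim (P : Kernel S S) (F C : Set S) (s : S) : ℝ≥0∞ := ⨅ j, stay P F C j s

variable {P : Kernel S S} {F C D : Set S} {s : S}

lemma stay_succ_of_notMem (hs : s ∉ C) (j : ℕ) : stay P F C (j + 1) s = 0 := by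
  simp [stay, hs]

lemma stay_succ_of_mem (hs : s ∈ C) (hF : s ∈ F) (j : ℕ) : stay P F C (j + 1) s = 1 := by
  simp [stay, hs, hF]

lemma stay_succ (hs : s ∈ C) (hF : s ∉ F) (j : ℕ) :
    stay P F C (j + 1) s = ∫⁻ u, stay P F C j u ∂(P s) := by
  simp [stay, hs, hF]

lemma stay_mono_set (h : C ⊆ D) (j : ℕ) (s : S) : stay P F C j s ≤ stay P F D j s := by
  induction j generalizing s with
  | zero => simp [stay]
  | succ j ih =>
    by_cases hs : s ∈ C
    · by_cases hF : s ∈ F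
      · rw [stay_succ_of_mem hs hF, stay_succ_of_mem (h hs) hF]
      · rw [stay_succ hs hF, stay_succ (h hs) hF]
        exact lintegral_mono ih
    · simp [stay_succ_of_notMem hs]

lemma stayLim_le (j : ℕ) (s : S) : stayLim P F C s ≤ stay P F C j s := iInf_le _ j

lemma stayLim_mono_set (h : C ⊆ D) (s : S) : stayLim P F C s ≤ stayLim P F D s :=
  iInf_mono fun j => stay_mono_set h j s

lemma stayLim_of_notMem (hs : s ∉ C) : stayLim P F C s = 0 :=
  le_antisymm ((stayLim_le 1 s).trans_eq (stay_succ_of_notMem hs 0)) bot_le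

variable [IsMarkovKernel P]

lemma stay_le_one (j : ℕ) (s : S) : stay P F C j s ≤ 1 := by
  induction j generalizing s with
  | zero => simp [stay]
  | succ j ih =>
    by_cases hs : s ∈ C
    · by_cases hF : s ∈ F
      · rw [stay_succ_of_mem hs hF]
      · rw [stay_succ hs hF]
        exact (lintegral_mono ih).trans (by simp)
    · simp [stay_succ_of_notMem hs]

lemma stay_succ_le (j : ℕ) (s : S) : stay P F C (j + 1) s ≤ stay P F C j s := by
  induction j generalizing s with
  | zero => exact stay_le_one _ _
  | succ j ih =>
    by_cases hs : s ∈ C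
    · by_cases hF : s ∈ F
      · rw [stay_succ_of_mem hs hF, stay_succ_of_mem hs hF]
      · rw [stay_succ hs hF, stay_succ hs hF]
        exact lintegral_mono ih
    · simp [stay_succ_of_notMem hs]

lemma stay_antitone (s : S) : Antitone fun j => stay P F C j s :=
  antitone_nat_of_succ_le fun j => stay_succ_le j s

lemma tendsto_stay (s : S) : Tendsto (fun j => stay P F C j s) atTop (𝓝 (stayLim P F C s)) :=
  tendsto_atTop_iInf (stay_antitone s)

lemma stayLim_le_one (s : S) : stayLim P F C s ≤ 1 := (stayLim_le 0 s).trans (stay_le_one 0 s)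

lemma stayLim_of_mem (hs : s ∈ C) (hF : s ∈ F) : stayLim P F C s = 1 := by
  refine le_antisymm (stayLim_le_one s) (le_iInf fun j => ?_)
  cases j with
  | zero => simp [stay]
  | succ j => rw [stay_succ_of_mem hs hF]

lemma lintegral_stayLim_le (hs : s ∈ C) : ∫⁻ u, stayLim P F C u ∂(P s) ≤ stayLim P F C s := by
  by_cases hF : s ∈ F
  · rw [stayLim_of_mem hs hF]
    exact (lintegral_mono stayLim_le_one).trans (by simp)
  · refine le_iInf fun j => (?_ : _ ≤ stay P F C (j + 1) s).trans (stay_succ_le j s)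
    rw [stay_succ hs hF]
    exact lintegral_mono (stayLim_le j)

instance (μ : Measure S) [IsProbabilityMeasure μ] : IsProbabilityMeasure (pathMeasure μ P) := by
  unfold pathMeasure; infer_instance

lemma pathMeasure_map_zero (μ : Measure S) [IsProbabilityMeasure μ] :
    (pathMeasure μ P).map (fun ω => ω 0) = μ := by
  have h1 : (fun ω : ℕ → S => ω 0) = (fun x : Finset.Iic 0 → S => x ⟨0, by simp⟩) ∘
      Preorder.frestrictLe (π := fun _ => S) 0 := rfl
  rw [h1, ← Measure.map_map (by fun_prop) (by fun_prop), pathMeasure, Kernel.trajMeasure,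
    Measure.map_comp _ _ (by fun_prop), Kernel.traj_map_frestrictLe, Kernel.partialTraj_self,
    Measure.id_comp, Measure.map_map (by fun_prop) (MeasurableEquiv.measurable _)]
  exact Measure.map_id

variable [DiscreteMeasurableSpace S]

lemma lintegral_stayLim (hs : s ∈ C) (hF : s ∉ F) :
    ∫⁻ u, stayLim P F C u ∂(P s) = stayLim P F C s := by
  refine le_antisymm (lintegral_stayLim_le hs) ?_
  unfold stayLim
  rw [lintegral_iInf (fun j => .of_discrete) (fun i j h u => stay_antitone u h)
    (by simp [stay])]
  exact le_iInf fun j => (iInf_le _ (j + 1)).trans_eq (stay_succ hs hF j)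

/-- A probability of staying in `C` forever that is bounded away from `1` vanishes. -/
lemma stayLim_eq_zero_of_le_half (h : ∀ s ∈ C, stayLim P ∅ C s ≤ 1 / 2) (s : S) :
    stayLim P ∅ C s = 0 := by
  -- Harmonicity carries the factor 1/2 from horizon 0 to every horizon; the limit reads `x ≤ x /
  -- 2`.
  have h' : ∀ j s, stayLim P ∅ C s ≤ 1 / 2 * stay P ∅ C j s := by
    intro j
    induction j with
    | zero =>
      intro s
      by_cases hs : s ∈ C
      · simpa [stay] using h s hs
      · simp [stayLim_of_notMem hs]
    | succ j ih =>
      intro s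
      by_cases hs : s ∈ C
      · rw [← lintegral_stayLim hs (Set.notMem_empty s), stay_succ hs (Set.notMem_empty s),
          ← lintegral_const_mul _ .of_discrete]
        exact lintegral_mono ih
      · simp [stayLim_of_notMem hs]
  have h1 : stayLim P ∅ C s ≤ 1 / 2 * stayLim P ∅ C s :=
    ge_of_tendsto' (ENNReal.Tendsto.const_mul (tendsto_stay s) (.inr (by simp))) fun j => h' j s
  have h2 : stayLim P ∅ C s ≠ ∞ := ((stayLim_le_one s).trans_lt (by simp)).ne
  by_contra h3
  refine absurd h1 (not_le.2 ?_)
  rw [one_div, mul_comm, ← div_eq_mul_inv]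
  exact ENNReal.half_lt_self h3 h2

/-- As the target sets shrink to the empty set, only the trajectories that stay in `C` remain. -/
lemma tendsto_stay_of_antitone {F : ℕ → Set S} (hF : ∀ s, ∀ᶠ n in atTop, s ∉ F n) (j : ℕ) (s : S) :
    Tendsto (fun n => stay P (F n) C j s) atTop (𝓝 (stay P ∅ C j s)) := by
  induction j generalizing s with
  | zero => simp [stay]
  | succ j ih =>
    by_cases hs : s ∈ C
    · rw [stay_succ hs (Set.notMem_empty s)]
      refine Tendsto.congr' (f₁ := fun n => ∫⁻ u, stay P (F n) C j u ∂(P s)) ?_ ?_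
      · filter_upwards [hF s] with n hn
        rw [stay_succ hs hn]
      · exact tendsto_lintegral_of_dominated_convergence (fun _ => 1) (fun n => .of_discrete)
          (fun n => ae_of_all _ (stay_le_one j)) (by simp) (ae_of_all _ ih)
    · simp [stay_succ_of_notMem hs]

/-- The limits in `n` and `j` need no interchange: a single horizon `j` with small `stay P ∅ C j s`
bounds `stayLim` for all large `n`. -/
lemma tendsto_stayLim_zero {F : ℕ → Set S} (hF : ∀ s, ∀ᶠ n in atTop, s ∉ F n)
    (hs : stayLim P ∅ C s = 0) : Tendsto (fun n => stayLim P (F n) C s) atTop (𝓝 0) := by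
  rw [ENNReal.tendsto_nhds_zero]
  intro ε hε
  obtain ⟨j, hj⟩ : ∃ j, stay P ∅ C j s < ε :=
    ((tendsto_stay s).eventually_lt_const (by rwa [hs])).exists
  filter_upwards [(tendsto_stay_of_antitone hF j s).eventually_lt_const hj] with n hn
  exact (stayLim_le j s).trans hn.le

/-! ### Staying probabilities under the path law -/

variable [Countable S] (μ : Measure S) [IsProbabilityMeasure μ]

/-- The one-step Markov property, in integrated form. -/
lemma lintegral_pathMeasure_succ (n : ℕ) {f : (Finset.Iic n → S) → ℝ≥0∞} (hf : Measurable f)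
    (g : S → ℝ≥0∞) :
    ∫⁻ ω, f (Preorder.frestrictLe n ω) * g (ω (n + 1)) ∂(pathMeasure μ P) =
      ∫⁻ ω, f (Preorder.frestrictLe n ω) * ∫⁻ u, g u ∂(P (ω n)) ∂(pathMeasure μ P) := by
  have hg : Measurable g := .of_discrete
  have key := Kernel.map_frestrictLe_trajMeasure_compProd_eq_map_trajMeasure
    (X := fun _ : ℕ => S) (μ₀ := μ) (a := n)
    (κ := fun n => P.comap (fun x : (Finset.Iic n → S) => x ⟨n, Finset.mem_Iic.2 le_rfl⟩)
      (measurable_pi_apply _))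
  have key2 := congrArg (fun ν => ∫⁻ x, f x.1 * g x.2 ∂ν) key
  rw [lintegral_map (by fun_prop) (by fun_prop), Measure.lintegral_compProd (by fun_prop),
    lintegral_map .of_discrete (by fun_prop)] at key2
  refine key2.symm.trans (lintegral_congr fun ω => ?_)
  simp only
  rw [lintegral_const_mul _ hg]
  rfl

/-- The Markov property trades the last step of the window for one more step of `stay`. -/
lemma lintegral_window (C : Set S) (n j l : ℕ) :
    ∫⁻ ω, {ω : ℕ → S | ∀ m, n ≤ m → m < n + j → ω m ∈ C}.indicator (fun _ => 1) ω * stay P ∅ C l (ω (n + j))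
      ∂(pathMeasure μ P) = ∫⁻ ω, stay P ∅ C (l + j) (ω n) ∂(pathMeasure μ P) := by
  induction j generalizing l with
  | zero =>
    refine lintegral_congr fun ω => ?_
    rw [Set.indicator_of_mem (by intro m h1 h2; omega)]
    simp
  | succ j ih =>
    rw [show l + (j + 1) = (l + 1) + j by ring, ← ih]
    let E : Set (Finset.Iic (n + j) → S) := {x | ∀ m, n ≤ m → ∀ h : m ∈ Finset.Iic (n + j), x ⟨m, h⟩ ∈ C}
    have hE : MeasurableSet E := .of_discrete
    have := lintegral_pathMeasure_succ (P := P) μ (n + j) (f := E.indicator fun _ => 1)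
      (measurable_const.indicator hE) (stay P ∅ C l)
    convert this using 1
    · refine lintegral_congr fun ω => ?_
      have h1 : ω ∈ {ω : ℕ → S | ∀ m, n ≤ m → m < n + (j + 1) → ω m ∈ C} ↔
          Preorder.frestrictLe (π := fun _ => S) (n + j) ω ∈ E := by
        simp [E, Order.lt_add_one_iff, ← add_assoc]
      exact congrArg₂ _ (Set.indicator_eq_indicator h1 rfl) rfl
    · refine lintegral_congr fun ω => ?_
      have h1 : Preorder.frestrictLe (π := fun _ => S) (n + j) ω ∈ E ↔
          (∀ m, n ≤ m → m < n + j → ω m ∈ C) ∧ ω (n + j) ∈ C := by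
        simp only [E, Set.mem_ofPred_eq, Finset.mem_Iic, Preorder.frestrictLe_apply]
        refine ⟨fun h => ⟨fun m a b => h m a b.le, h _ (by omega) le_rfl⟩, fun h m a b => ?_⟩
        rcases b.lt_or_eq with b | rfl
        exacts [h.1 m a b, h.2]
      by_cases hC : ω (n + j) ∈ C
      · rw [stay_succ hC (Set.notMem_empty _)]
        refine congrArg₂ _ (Set.indicator_eq_indicator ?_ rfl) rfl
        rw [h1]
        simp [hC]
      · simp [stay_succ_of_notMem hC, h1, hC]

/-- The probability of staying in `C` from time `n` on. -/
lemma pathMeasure_forall_ge (C : Set S) (n : ℕ) :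
    pathMeasure μ P {ω | ∀ m, n ≤ m → ω m ∈ C} =
      ∫⁻ ω, stayLim P ∅ C (ω n) ∂(pathMeasure μ P) := by
  have hm : ∀ j, MeasurableSet {ω : ℕ → S | ∀ m, n ≤ m → m < n + j → ω m ∈ C} := by
    intro j
    simp only [Set.ofPred_forall]
    exact .iInter fun m => .iInter fun _ => .iInter fun _ => measurable_pi_apply m .of_discrete
  have h1 : ∀ j, pathMeasure μ P {ω | ∀ m, n ≤ m → m < n + j → ω m ∈ C} =
      ∫⁻ ω, stay P ∅ C j (ω n) ∂(pathMeasure μ P) := by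
    intro j
    have := lintegral_window (P := P) μ C n j 0
    simp only [stay, mul_one, zero_add] at this
    rwa [lintegral_indicator_const (hm j), one_mul] at this
  have h2 := lintegral_iInf (μ := pathMeasure μ P) (f := fun j (ω : ℕ → S) => stay P ∅ C j (ω n))
    (fun j => (Measurable.of_discrete (f := stay P ∅ C j)).comp (measurable_pi_apply n))
    (fun i j h u => stay_antitone _ h) (by simp [stay])
  refine Eq.trans ?_ h2.symm
  simp_rw [← h1]
  rw [← Antitone.measure_iInter]
  · congr 1
    ext ω
    simp only [Set.mem_ofPred_eq, Set.mem_iInter]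
    exact ⟨fun h _ m a _ => h m a, fun h m a => h (m + 1) m a (by omega)⟩
  · exact fun i j hij ω h m a b => h m a (by omega)
  · exact fun j => (hm j).nullMeasurableSet
  · exact ⟨0, measure_ne_top _ _⟩

end StayProbability

/-- A positive function is bounded below by a positive antitone function of `W`, if the sublevel
sets of `W` are finite. -/
lemma exists_antitone_le {S : Type*} {C : Set S} {W : S → ℝ≥0} (hW : ∀ r, {s ∈ C | W s ≤ r}.Finite)
    {δ : S → ℝ≥0} (hδ : ∀ s ∈ C, 0 < δ s) :
    ∃ d : ℝ≥0 → ℝ≥0, Antitone d ∧ (∀ r, 0 < d r) ∧ (∀ r, d r ≤ 1) ∧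
      ∀ s ∈ C, d (W s) ≤ δ s := by
  -- Inserting 1 keeps the set nonempty (`sInf ∅ = 0`) and bounds the infimum by 1.
  let D : ℝ≥0 → Set ℝ≥0 := fun r => insert 1 (δ '' {s ∈ C | W s ≤ r})
  have hD : ∀ r, BddBelow (D r) := fun r => OrderBot.bddBelow _
  refine ⟨fun r => sInf (D r), fun r₁ r₂ h => ?_, fun r => ?_, fun r => ?_, fun s hs => ?_⟩
  · refine csInf_le_csInf (hD _) (Set.insert_nonempty _ _) ?_
    exact Set.insert_subset_insert (Set.image_mono fun s hs => ⟨hs.1, hs.2.trans h⟩)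
  · rcases Set.Nonempty.csInf_mem (Set.insert_nonempty _ _) (((hW r).image δ).insert 1) with h | h
    · simp only [D]
      rw [h]
      exact one_pos
    · obtain ⟨s, hs, h⟩ := h
      simp only [D]
      rw [← h]
      exact hδ s hs.1
  · exact csInf_le (hD r) (Set.mem_insert _ _)
  · exact csInf_le (hD _) (Set.mem_insert_of_mem _ ⟨s, ⟨hs, le_rfl⟩, rfl⟩)

/-! ### Certificates -/

variable {S : Type*} [MeasurableSpace S] [DiscreteMeasurableSpace S]
  {P : Kernel S S} [IsMarkovKernel P]

/-- A bounded function that is strictly superharmonic on `C`. -/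
lemma exists_strict_superharmonic {C : Set S} (hC : ∀ s, stayLim P ∅ C s = 0) :
    ∃ G : S → ℝ≥0∞, (∀ s, G s ≤ 2) ∧ (∀ s ∉ C, G s = 0) ∧
      ∀ s ∈ C, ∫⁻ u, G u ∂(P s) < G s := by
  have hle : ∀ x : ℕ → ℝ≥0∞, (∀ j, x j ≤ 1) → ∑' j, 2⁻¹ ^ j * x j ≤ 2 := by
    intro x hx
    refine (ENNReal.tsum_le_tsum fun j => mul_le_of_le_one_right' (hx j)).trans_eq ?_
    rw [ENNReal.tsum_geometric, ENNReal.one_sub_inv_two, inv_inv]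
  -- The index starts at 1 because `stay` at horizon 0 is 1 even off `C`. Integration shifts the
  -- horizon by one, so some strict decrease in `j` suffices.
  refine ⟨fun s => ∑' j : ℕ, 2⁻¹ ^ j * stay P ∅ C (j + 1) s, fun s => hle _ fun j =>
    stay_le_one _ s, fun s hs => by simp [stay_succ_of_notMem hs], fun s hs => ?_⟩
  have hne : (s ∉ (∅ : Set S)) := Set.notMem_empty s
  rw [lintegral_tsum fun j => AEMeasurable.of_discrete]
  simp_rw [lintegral_const_mul _ (Measurable.of_discrete (f := stay P ∅ C _)), ← stay_succ hs hne]
  obtain ⟨i, hi⟩ : ∃ i, stay P ∅ C (i + 1 + 1) s < stay P ∅ C (i + 1) s := by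
    by_contra! hcon
    have h1 : ∀ i, 1 ≤ stay P ∅ C (i + 1) s := by
      intro i
      induction i with
      | zero => rw [stay_succ hs hne]; simp [stay]
      | succ i ih => exact ih.trans (hcon i)
    have h2 : 1 ≤ stayLim P ∅ C s := le_iInf fun j => (h1 j).trans (stay_succ_le j s)
    simp [hC] at h2
  refine ENNReal.tsum_lt_tsum (i := i) ?_ (fun j => ?_) ?_
  · exact ne_top_of_le_ne_top (by simp) (hle _ fun j => stay_le_one _ s)
  · gcongr
    exact stay_succ_le _ s
  · exact ENNReal.mul_lt_mul_right (by simp) (by simp) hi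

variable [Countable S] (μ : Measure S) [IsProbabilityMeasure μ]

/-- If `A` is almost surely visited finitely often or `B` infinitely often, then from every state
that is reached with positive probability the chain almost surely enters `B` or a state from
which `A` is avoided forever with probability at least one half. -/
lemma stayLim_eq_zero_of_ae {A B : Set S}
    (h : ∀ᵐ ω ∂(pathMeasure μ P), ω ∈ finVisits A ∪ infVisits B) {n : ℕ} {s : S}
    (hs : pathMeasure μ P {ω | ω n = s} ≠ 0) :
    stayLim P ∅ (B ∪ {u | 1 / 2 ≤ stayLim P ∅ Aᶜ u})ᶜ s = 0 := by
  set T := B ∪ {u | 1 / 2 ≤ stayLim P ∅ Aᶜ u}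
  have he : ∀ u, stayLim P ∅ (Tᶜ ∩ Aᶜ) u = 0 := by
    refine stayLim_eq_zero_of_le_half fun u hu => ?_
    have h1 : ¬ 1 / 2 ≤ stayLim P ∅ Aᶜ u := fun h => hu.1 (Or.inr h)
    exact (stayLim_mono_set Set.inter_subset_right u).trans (not_le.1 h1).le
  have h0 : pathMeasure μ P {ω | ∀ m, n ≤ m → ω m ∈ Tᶜ} = 0 := by
    refine measure_mono_null (t := {ω | ω ∈ finVisits A ∪ infVisits B}ᶜ ∪
      ⋃ N, {ω | ∀ m, N ≤ m → ω m ∈ Tᶜ ∩ Aᶜ}) ?_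
      (measure_union_null h (measure_iUnion_null fun N => by
        rw [pathMeasure_forall_ge]; simp [he]))
    intro ω hω
    by_cases hr : ω ∈ finVisits A ∪ infVisits B
    · right
      rcases hr with hr | hr
      · obtain ⟨N, hN⟩ := Set.mem_iUnion.1 hr
        simp only [Set.mem_iInter] at hN
        exact Set.mem_iUnion.2 ⟨max n N, fun m hm =>
          ⟨hω m (le_of_max_le_left hm), hN m (le_of_max_le_right hm)⟩⟩
      · simp only [infVisits, Set.mem_iInter, Set.mem_iUnion] at hr
        obtain ⟨m, hm, hB⟩ := hr n
        exact absurd (Or.inl hB) (hω m hm)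
    · exact Or.inl hr
  rw [pathMeasure_forall_ge] at h0
  replace h0 := (lintegral_eq_zero_iff
    ((Measurable.of_discrete (f := stayLim P ∅ Tᶜ)).comp (measurable_pi_apply n))).1 h0
  by_contra hne
  refine hs (measure_mono_null ?_ h0)
  rintro ω rfl
  exact hne

/-- The states that are reached with positive probability form a closed set. -/
lemma kernel_reachable_compl {s : S} (hs : ∃ n, pathMeasure μ P {ω | ω n = s} ≠ 0) :
    P s {u | ∃ n, pathMeasure μ P {ω | ω n = u} ≠ 0}ᶜ = 0 := by
  set I := {u | ∃ n, pathMeasure μ P {ω | ω n = u} ≠ 0}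
  have h0 : ∀ n, pathMeasure μ P {ω | ω n ∈ Iᶜ} = 0 := by
    intro n
    have : {ω : ℕ → S | ω n ∈ Iᶜ} = ⋃ u ∈ Iᶜ, {ω | ω n = u} := by ext; simp
    rw [this, measure_biUnion_null_iff (Set.to_countable _)]
    intro u hu
    by_contra hne
    exact hu ⟨n, hne⟩
  obtain ⟨n, hn⟩ := hs
  -- The mass of `Iᶜ` at time `n + 1` is the mean of `P (ω n) Iᶜ`.
  have h1 := lintegral_pathMeasure_succ (P := P) μ n (f := fun _ => 1) measurable_const
    (Iᶜ.indicator fun _ => 1)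
  have h2 : ∫⁻ ω, Iᶜ.indicator (fun _ => 1) (ω (n + 1)) ∂(pathMeasure μ P) = 0 := by
    have := lintegral_indicator_one (μ := pathMeasure μ P)
      (measurable_pi_apply (X := fun _ : ℕ => S) (n + 1) (MeasurableSet.of_discrete (s := Iᶜ)))
    exact this.trans (h0 (n + 1))
  simp only [one_mul, h2, lintegral_indicator_const MeasurableSet.of_discrete] at h1
  replace h1 := (lintegral_eq_zero_iff
    ((Measurable.of_discrete (f := fun u => P u Iᶜ)).comp (measurable_pi_apply n))).1 h1.symm
  by_contra hne
  refine hn (measure_mono_null ?_ h1)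
  rintro ω rfl
  exact hne

lemma measure_reachable_compl : μ {u | ∃ n, pathMeasure μ P {ω | ω n = u} ≠ 0}ᶜ = 0 := by
  rw [← Set.biUnion_of_singleton ({u | ∃ n, pathMeasure μ P {ω | ω n = u} ≠ 0}ᶜ),
    measure_biUnion_null_iff (Set.to_countable _)]
  intro u hu
  rw [← pathMeasure_map_zero (P := P) μ, Measure.map_apply (by fun_prop) .of_discrete]
  by_contra hne
  exact hu ⟨0, hne⟩

/-- A superharmonic function on `C` with finite sublevel sets in `C`. -/
lemma exists_superharmonic_finite_sublevel {C : Set S} (hC : ∀ s, stayLim P ∅ C s = 0) :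
    ∃ W : S → ℝ≥0∞, (∀ s, W s ≠ ∞) ∧ (∀ s ∉ C, W s = 0) ∧ (∀ s, ∫⁻ u, W u ∂(P s) ≠ ∞) ∧
      (∀ s ∈ C, ∫⁻ u, W u ∂(P s) ≤ W s) ∧ ∀ m : ℕ, {s ∈ C | W s ≤ m}.Finite := by
  obtain ⟨f, hf⟩ := Countable.exists_injective_nat S
  let F : ℕ → Set S := fun n => {s | n ≤ f s}
  have hF : ∀ s, ∀ᶠ n in atTop, s ∉ F n := fun s => by
    filter_upwards [eventually_gt_atTop (f s)] with n hn
    simpa [F] using hn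
  have h1 : ∀ s, Tendsto (fun n => stayLim P (F n) C s) atTop (𝓝 0) :=
    fun s => tendsto_stayLim_zero hF (hC s)
  have h2 : ∀ s, Tendsto (fun n => ∫⁻ u, stayLim P (F n) C u ∂(P s)) atTop (𝓝 0) := fun s => by
    simpa using tendsto_lintegral_of_dominated_convergence (μ := P s) (fun _ => 1)
      (fun n => .of_discrete) (fun n => ae_of_all _ stayLim_le_one) (by simp) (ae_of_all _ h1)
  -- The bound on the integrals is needed off `C`, where superharmonicity does not control the
  -- post-expectation.
  have h3 : ∀ j : ℕ, ∃ n, ∀ s, f s ≤ j → stayLim P (F n) C s ≤ 2⁻¹ ^ j ∧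
      ∫⁻ u, stayLim P (F n) C u ∂(P s) ≤ 2⁻¹ ^ j := by
    intro j
    have hfin : (f ⁻¹' Set.Iic j).Finite := (Set.finite_Iic j).preimage hf.injOn
    have hε : (0 : ℝ≥0∞) < 2⁻¹ ^ j := ENNReal.pow_pos (by simp) j
    exact ((eventually_all_finite hfin).2 fun s _ =>
      (ENNReal.tendsto_nhds_zero.1 (h1 s) _ hε).and (ENNReal.tendsto_nhds_zero.1 (h2 s) _ hε)).exists
  choose n hn using h3
  have hsum : ∀ (x : ℕ → ℝ≥0∞) (N : ℕ), (∀ j, x j ≤ 1) → (∀ j, N ≤ j → x j ≤ 2⁻¹ ^ j) →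
      ∑' j, x j ≠ ∞ := by
    intro x N hx1 hx2
    rw [← ENNReal.summable.sum_add_tsum_nat_add' (f := x) (k := N)]
    refine ENNReal.add_ne_top.2 ⟨(ENNReal.sum_lt_top.2 fun j _ =>
      (hx1 j).trans_lt (by simp)).ne, ?_⟩
    refine ne_top_of_le_ne_top (b := ∑' j : ℕ, (2⁻¹ : ℝ≥0∞) ^ j) ?_
      (ENNReal.tsum_le_tsum fun j => (hx2 _ (by omega)).trans ?_)
    · rw [ENNReal.tsum_geometric]; simp
    · exact pow_le_pow_right_of_le_one' (by simp) (by omega)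
  refine ⟨fun s => ∑' j, stayLim P (F (n j)) C s, fun s => ?_, fun s hs => ?_, fun s => ?_,
    fun s hs => ?_, fun m => ?_⟩
  · exact hsum _ (f s) (fun j => stayLim_le_one s) fun j hj => (hn j s hj).1
  · simp [stayLim_of_notMem hs]
  · rw [lintegral_tsum fun j => AEMeasurable.of_discrete]
    exact hsum _ (f s) (fun j => (lintegral_mono stayLim_le_one).trans (by simp))
      fun j hj => (hn j s hj).2
  · rw [lintegral_tsum fun j => AEMeasurable.of_discrete]
    exact ENNReal.tsum_le_tsum fun j => lintegral_stayLim_le hs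
  · refine ((Set.finite_Iio (∑ j ∈ Finset.range (m + 1), n j)).preimage hf.injOn).subset ?_
    rintro s ⟨hs, hW⟩
    by_contra hlt
    have hge : ∑ j ∈ Finset.range (m + 1), n j ≤ f s := not_lt.1 hlt
    refine absurd hW (not_le.2 ?_)
    calc (m : ℝ≥0∞) < (m + 1 : ℕ) := by exact_mod_cast m.lt_succ_self
      _ = ∑ j ∈ Finset.range (m + 1), stayLim P (F (n j)) C s := by
        rw [Finset.sum_congr rfl fun j hj => stayLim_of_mem hs (?_ : s ∈ F (n j))]
        · simp
        · exact (Finset.single_le_sum (f := n) (fun _ _ => Nat.zero_le _) hj).trans hge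
      _ ≤ _ := ENNReal.sum_le_tsum _

/-- A termination certificate for a set that is left almost surely. -/
lemma exists_termination_certificate {C : Set S} (hC : ∀ s, stayLim P ∅ C s = 0) :
    ∃ W d p : _ → ℝ≥0, (∀ s, postExp P W s < ∞) ∧ (∀ s ∈ C, 0 < W s) ∧ (∀ s ∉ C, W s = 0) ∧
      (∀ s ∈ C, postExp P W s ≤ W s) ∧ Antitone d ∧ Antitone p ∧ (∀ r, 0 < d r) ∧
      (∀ r, 0 < p r) ∧ (∀ r, p r ≤ 1) ∧
      ∀ s ∈ C, (p (W s) : ℝ≥0∞) ≤ P s {u | (W u : ℝ) ≤ (W s : ℝ) - (d (W s) : ℝ)} := by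
  obtain ⟨H, H1, H2, H3, H4, H5⟩ := exists_superharmonic_finite_sublevel hC
  obtain ⟨G, G1, G2, G3⟩ := exists_strict_superharmonic hC
  have G1' : ∀ s, G s ≠ ∞ := fun s => ne_top_of_le_ne_top (by simp) (G1 s)
  let W : S → ℝ≥0 := fun s => (H s + G s).toNNReal
  have hW : ∀ s, (W s : ℝ≥0∞) = H s + G s := fun s =>
    ENNReal.coe_toNNReal (ENNReal.add_ne_top.2 ⟨H1 s, G1' s⟩)
  have hP : ∀ s, postExp P W s = ∫⁻ u, H u ∂(P s) + ∫⁻ u, G u ∂(P s) := fun s => by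
    simp_rw [postExp, hW]
    exact lintegral_add_left .of_discrete _
  have hlt : ∀ s ∈ C, postExp P W s < W s := fun s hs => by
    rw [hP, hW]
    exact ENNReal.add_lt_add_of_le_of_lt (H3 s) (H4 s hs) (G3 s hs)
  have hfin : ∀ r, {s ∈ C | W s ≤ r}.Finite := by
    intro r
    obtain ⟨m, hm⟩ := exists_nat_ge r
    refine (H5 m).subset fun s hs => ⟨hs.1, le_self_add.trans ((hW s).symm.trans_le ?_)⟩
    exact_mod_cast hs.2.trans hm
  have hstep : ∀ s, ∃ δ : ℝ≥0, s ∈ C →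
      0 < δ ∧ 0 < P s {u | (W u : ℝ) ≤ (W s : ℝ) - (δ : ℝ)} := by
    intro s
    by_contra! hcon
    have hs : s ∈ C := (hcon 0).1
    -- Without a drop of positive probability, `W u ≥ W s` almost surely, against strict
    -- superharmonicity.
    have h0 : P s (⋃ n : ℕ, {u | (W u : ℝ) ≤ W s - (((n : ℝ≥0) + 1)⁻¹ : ℝ≥0)}) = 0 :=
      measure_iUnion_null fun n => le_antisymm ((hcon _).2 (by positivity)) bot_le
    have h1 : (W s : ℝ≥0∞) ≤ postExp P W s := by
      calc (W s : ℝ≥0∞) = ∫⁻ _, W s ∂(P s) := by simp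
        _ ≤ _ := lintegral_mono_ae ?_
      filter_upwards [compl_mem_ae_iff.2 h0] with u hu
      by_contra hlt
      have hlt' : (W u : ℝ) < W s := by exact_mod_cast not_le.1 hlt
      obtain ⟨n, hn⟩ := exists_nat_one_div_lt (sub_pos.2 hlt')
      refine hu (Set.mem_iUnion.2 ⟨n, ?_⟩)
      simp only [Set.mem_ofPred_eq]
      push_cast
      rw [one_div] at hn
      linarith
    exact absurd (hlt s hs) (not_lt.2 h1)
  choose δ hδ using hstep
  obtain ⟨d, d1, d2, -, d4⟩ := exists_antitone_le hfin fun s hs => (hδ s hs).1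
  obtain ⟨p, p1, p2, p3, p4⟩ := exists_antitone_le hfin
    (δ := fun s => (P s {u | (W u : ℝ) ≤ (W s : ℝ) - (δ s : ℝ)}).toNNReal)
    fun s hs => ENNReal.toNNReal_pos (hδ s hs).2.ne' (measure_ne_top _ _)
  refine ⟨W, d, p, fun s => ?_, fun s hs => ?_, fun s hs => ?_, fun s hs => (hlt s hs).le, d1, p1,
    d2, p2, p3, fun s hs => ?_⟩
  · rw [hP]
    refine ENNReal.add_lt_top.2 ⟨(H3 s).lt_top, (lintegral_mono G1).trans_lt (by simp)⟩
  · exact ENNReal.coe_pos.1 ((zero_le (a := postExp P W s)).trans_lt (hlt s hs))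
  · simp [W, H2 s hs, G2 s hs]
  · refine (ENNReal.coe_le_coe.2 (p4 s hs)).trans ?_
    rw [ENNReal.coe_toNNReal (measure_ne_top _ _)]
    refine measure_mono fun u (hu : (W u : ℝ) ≤ W s - δ s) => ?_
    have : (d (W s) : ℝ) ≤ δ s := by exact_mod_cast d4 s hs
    exact hu.trans (by linarith)

end StreettChain

/-! ### Assembly of the proof rule -/

open StreettChain in
theorem mainTheorem12 {S : Type*} [Countable S] [MeasurableSpace S] [DiscreteMeasurableSpace S]
    (μ : Measure S) [IsProbabilityMeasure μ] (P : Kernel S S) [IsMarkovKernel P]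
    {k : ℕ} (A B : Fin k → Set S)
    (h : pathMeasure μ P (reactivity A B) = 1) :
    ∃ (I : Set S) (V₀ : S → ℝ≥0) (J : Fin k → Set S) (V W : Fin k → S → ℝ≥0)
      (d p : Fin k → ℝ≥0 → ℝ≥0),
      ProofRuleTwo P A B I V₀ J V W d p ∧ initExp μ V₀ = 0 := by
  classical
  set I : Set S := {u | ∃ n, pathMeasure μ P {ω | ω n = u} ≠ 0}
  let a : Fin k → S → ℝ≥0∞ := fun i => stayLim P ∅ (A i)ᶜ
  let J : Fin k → Set S := fun i => I ∩ {u | 1 / 2 ≤ a i u}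
  have hmeas : MeasurableSet (reactivity A B) := by
    refine .iInter fun i => .union ?_ ?_
    · exact .iUnion fun n => .iInter fun m => .iInter fun _ =>
        measurable_pi_apply (X := fun _ => S) m (MeasurableSet.of_discrete (s := (A i)ᶜ))
    · exact .iInter fun n => .iUnion fun m => .iUnion fun _ =>
        measurable_pi_apply (X := fun _ => S) m (MeasurableSet.of_discrete (s := B i))
  have hae : ∀ᵐ ω ∂(pathMeasure μ P), ω ∈ reactivity A B :=
    (mem_ae_iff_prob_eq_one hmeas).2 h
  have hC : ∀ i s, stayLim P ∅ (I \ (B i ∪ J i)) s = 0 := by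
    intro i s
    by_cases hs : s ∈ I
    · obtain ⟨n, hn⟩ := hs
      refine le_antisymm ((stayLim_mono_set ?_ s).trans_eq (stayLim_eq_zero_of_ae μ
        (hae.mono fun ω hω => Set.mem_iInter.1 hω i) hn)) bot_le
      rintro u ⟨hu, hu'⟩ (hB | ha)
      exacts [hu' (Or.inl hB), hu' (Or.inr ⟨hu, ha⟩)]
    · exact stayLim_of_notMem fun h => hs h.1
  choose W d p W1 W2 W3 W4 d1 p1 d2 p2 p3 W5 using fun i => exists_termination_certificate (hC i)
  have ha : ∀ i s, a i s ≠ ∞ := fun i s => ne_top_of_le_ne_top (by simp) (stayLim_le_one s)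
  let V : Fin k → S → ℝ≥0 := fun i s => (1 - a i s).toNNReal
  have hV : ∀ i s, (V i s : ℝ≥0∞) = 1 - a i s := fun i s =>
    ENNReal.coe_toNNReal (ENNReal.sub_ne_top (by simp))
  let V₀ : S → ℝ≥0 := Iᶜ.indicator fun _ => 1
  have hV₀ : ∀ ν : Measure S, ∫⁻ u, (V₀ u : ℝ≥0∞) ∂ν = ν Iᶜ := fun ν => by
    rw [← lintegral_indicator_one MeasurableSet.of_discrete]
    refine lintegral_congr fun u => ?_
    by_cases hu : u ∈ I <;> simp [V₀, hu]
  refine ⟨I, V₀, J, V, W, d, p, ?_, (hV₀ μ).trans (measure_reachable_compl μ)⟩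
  refine
    { post_V₀_lt_top := fun s => (hV₀ _).trans_lt (measure_lt_top _ _)
      post_V_lt_top := fun i s => ?_
      post_W_lt_top := W1
      d_pos := d2
      p_pos := p2
      p_le_one := p3
      absorbing_subset := fun i s hs => ⟨hs.1, fun hA => ?_⟩
      V_post := fun i s hs => ?_
      V_ge_one := fun i s hs => ?_
      V_gap := fun i => ⟨1 / 2, by norm_num, fun s hs => ?_⟩
      W_pos := W2
      W_zero := fun i s hs => W3 i s fun h => h.2 hs.2
      W_post := W4
      W_drift := ?_
      p_antitone := fun i _ _ _ _ h => p1 i h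
      d_antitone := fun i _ _ _ _ h => d1 i h
      V₀_post := fun s hs => ((hV₀ _).trans (kernel_reachable_compl μ hs)).trans_le bot_le
      V₀_ge_one := fun s hs => by simp [V₀, hs] }
  · refine (lintegral_mono (g := fun _ => 1) fun u => ?_).trans_lt (by simp)
    rw [hV]
    exact tsub_le_self
  · have h2 := hs.2
    simp [a, stayLim_of_notMem (P := P) (F := ∅) (Set.notMem_compl_iff.2 hA)] at h2
  · simp_rw [postExp, hV]
    rw [lintegral_sub .of_discrete ((lintegral_mono stayLim_le_one).trans_lt (by simp)).ne
      (ae_of_all _ stayLim_le_one), lintegral_stayLim hs (Set.notMem_empty s)]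
    simp [a]
  · simp [V, a, stayLim_of_notMem (P := P) (F := ∅) (Set.notMem_compl_iff.2 hs)]
  · have h1 : (V i s : ℝ≥0∞) ≤ (1 / 2 : ℝ≥0) := by
      rw [hV]
      refine (tsub_le_tsub_left hs.2 1).trans ?_
      simp
    have h2 : V i s ≤ 1 / 2 := by exact_mod_cast h1
    have h3 : (V i s : ℝ) ≤ ((1 / 2 : ℝ≥0) : ℝ) := by exact_mod_cast h2
    refine h3.trans ?_
    norm_num
  · rintro i r hr s hs rfl
    exact W5 i s hs
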